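/- All graphs are finite and simple. For a graph $G$, let $P(G,x)$ denote its chromatic polynomial, i.e. the unique real polynomial such that, for every positive integer $k$, $P(G,k)$ is the number of proper $k$-colourings of $G$; and put $\epsilon(G,x)=P'(G,x)/P(G,x)$, where $P'$ is the derivative with respect to $x$. A graph $Q$ is chordal if no cycle $C$ of $Q$ with at least four vertices is an induced subgraph of $Q$ (equivalently, every such cycle has a chord). Theorem. Let $G$ be a graph and let $Q$ be a chordal and proper spanning subgraph of $G$ (that is, $V(Q)=V(G)$ and $E(Q)\subsetneq E(G)$). Then for all real $x<0$ both $P(G,x)$ and $P(Q,x)$ are non-zero (so that $\epsilon(G,x)$ and $\epsilon(Q,x)$ are defined) and $$\epsilon(G,x)>\epsilon(Q,x).$$ -/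

import Mathlib

namespace SimpleGraph

/-- The number of maps `V → Fin k` that are constant on the edges of a finite graph `H` is
`k ^ c`, where `c` is the number of connected components of `H`. -/
theorem card_maps_constant_on_edges {V : Type*} [Finite V] (H : SimpleGraph V) (k : ℕ) :
    Nat.card {f : V → Fin k // ∀ u v, H.Adj u v → f u = f v} =
      k ^ Nat.card H.ConnectedComponent := by
  have e : {f : V → Fin k // ∀ u v, H.Adj u v → f u = f v} ≃ (H.ConnectedComponent → Fin k) :=
    { toFun := fun f => ConnectedComponent.lift f.1 (fun v w p _ => by
        clear * - p
        induction p with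
        | nil => rfl
        | cons h p ih => exact (f.2 _ _ h).trans ih)
      invFun := fun g => ⟨fun v => g (H.connectedComponentMk v), fun u v h => by
        exact congrArg g (ConnectedComponent.connectedComponentMk_eq_of_adj h)⟩
      left_inv := fun f => by ext v; rfl
      right_inv := fun g => by
        funext c
        induction c using ConnectedComponent.ind
        rfl }
  rw [Nat.card_congr e, Nat.card_fun, Nat.card_fin]

/-- The number of proper colourings with `k` colours is a polynomial in `k`: there is exactly
one real polynomial whose value at every positive integer `k` is the number of proper
`k`-colourings of the finite graph `G`. -/
theorem existsUnique_chromaticPolynomial {V : Type*} [Finite V] (G : SimpleGraph V) :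
    ∃! p : Polynomial ℝ, ∀ k : ℕ, 0 < k → p.eval (k : ℝ) = Nat.card (G.Coloring (Fin k)) := by
  classical
  have := Fintype.ofFinite V
  refine existsUnique_of_exists_of_unique ?_ ?_
  · refine ⟨∑ A ∈ G.edgeFinset.powerset, (-1) ^ A.card *
      Polynomial.X ^ Nat.card (fromEdgeSet (A : Set (Sym2 V))).ConnectedComponent, ?_⟩
    intro k _
    have mono : ∀ (f : V → Fin k) (A : Finset (Sym2 V)), A ∈ G.edgeFinset.powerset →
        ((∀ e ∈ A, (e.map f).IsDiag) ↔
          ∀ u v, (fromEdgeSet (A : Set (Sym2 V))).Adj u v → f u = f v) := by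
      intro f A hA
      constructor
      · intro h u v huv
        rw [fromEdgeSet_adj] at huv
        simpa using h _ huv.1
      · intro h e he
        have heG : e ∈ G.edgeSet := by
          simpa using Finset.mem_powerset.mp hA he
        induction e with
        | h u v =>
          have : u ≠ v := by
            rintro rfl
            simp at heG
          simpa using h u v (by simp [this, he])
    have col : ∀ f : V → Fin k, (∀ u v, G.Adj u v → f u ≠ f v) ↔
        ∀ e ∈ G.edgeFinset, ¬ (e.map f).IsDiag := by
      intro f
      constructor
      · intro h e he
        induction e with
        | h u v => simpa using h u v (by simpa using he)
      · intro h u v huv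
        simpa using h s(u, v) (by simpa using huv)
    have e : G.Coloring (Fin k) ≃ {f : V → Fin k // ∀ u v, G.Adj u v → f u ≠ f v} :=
      { toFun := fun C => ⟨C, fun u v h => C.valid h⟩
        invFun := fun f => Coloring.mk f.1 (fun {u v} h => f.2 u v h)
        left_inv := fun C => by ext v; rfl
        right_inv := fun f => by ext v; rfl }
    rw [Nat.card_congr e, Nat.card_eq_fintype_card, Fintype.card_subtype, Finset.card_filter]
    push_cast
    have key : ∀ f : V → Fin k, (if (∀ u v, G.Adj u v → f u ≠ f v) then (1 : ℝ) else 0) =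
        ∑ A ∈ G.edgeFinset.powerset, (-1) ^ A.card *
          (if (∀ u v, (fromEdgeSet (A : Set (Sym2 V))).Adj u v → f u = f v)
            then (1 : ℝ) else 0) := by
      intro f
      have h1 : (if (∀ u v, G.Adj u v → f u ≠ f v) then (1 : ℝ) else 0) =
          ∏ e ∈ G.edgeFinset, (-(if (e.map f).IsDiag then (1 : ℝ) else 0) + 1) := by
        rw [if_congr (col f) rfl rfl]
        refine Eq.trans ?_ ((Finset.prod_boole (s := G.edgeFinset)
          (p := fun e => ¬ (e.map f).IsDiag)).symm.trans (Finset.prod_congr rfl fun e _ => ?_))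
        · congr
        · by_cases h : (e.map f).IsDiag <;> simp [h]
      rw [h1, Finset.prod_add_one]
      refine Finset.sum_congr rfl fun A hA => ?_
      rw [Finset.prod_neg, Finset.prod_boole]
      congr 1
      by_cases h : ∀ e ∈ A, (e.map f).IsDiag
      · rw [if_pos h, if_pos ((mono f A hA).1 h)]
      · rw [if_neg h, if_neg fun h' => h ((mono f A hA).2 h')]
    rw [Finset.sum_congr rfl fun f _ => key f, Finset.sum_comm, Polynomial.eval_finsetSum]
    refine Finset.sum_congr rfl fun A _ => ?_
    rw [← Finset.mul_sum, Finset.sum_boole, ← Fintype.card_subtype, ← Nat.card_eq_fintype_card,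
      card_maps_constant_on_edges]
    simp
  · intro p q hp hq
    refine Polynomial.eq_of_infinite_eval_eq p q ?_
    refine Set.Infinite.mono ?_ (Set.infinite_range_of_injective
      (f := fun n : ℕ => ((n + 1 : ℕ) : ℝ)) fun a b h => by simpa using h)
    rintro _ ⟨n, rfl⟩
    exact (hp _ n.succ_pos).trans (hq _ n.succ_pos).symm

/-- The chromatic polynomial `P(G, x)` of a finite graph `G`: the unique real polynomial such
that `P(G, k)` is the number of proper `k`-colourings of `G` for every positive integer `k`. -/
noncomputable def chromaticPolynomial {V : Type*} [Finite V] (G : SimpleGraph V) :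
    Polynomial ℝ :=
  (existsUnique_chromaticPolynomial G).choose

theorem chromaticPolynomial_eval {V : Type*} [Finite V] (G : SimpleGraph V) (k : ℕ)
    (hk : 0 < k) :
    G.chromaticPolynomial.eval (k : ℝ) = Nat.card (G.Coloring (Fin k)) :=
  (existsUnique_chromaticPolynomial G).choose_spec.1 k hk

/-- The function `ε(G, x) = P'(G, x) / P(G, x)`. -/
noncomputable def chromaticEpsilon {V : Type*} [Finite V] (G : SimpleGraph V) (x : ℝ) : ℝ :=
  G.chromaticPolynomial.derivative.eval x / G.chromaticPolynomial.eval x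

/-- A graph is chordal if no cycle `C` on at least four vertices is an induced subgraph, i.e.
every cycle of length at least four has a chord. -/
def IsChordal {V : Type*} (Q : SimpleGraph V) : Prop :=
  ∀ (u : V) (C : Q.Walk u u), C.IsCycle → 4 ≤ C.length → ¬ C.toSubgraph.IsInduced

end SimpleGraph

namespace SimpleGraph

/-! For `x < 0` the value `P(G, x)` has sign `(-1) ^ n`, where `n` is the number of vertices. Induct
on `n`, then on `G` under edge deletion, for fixed `Q`. By Dirac's theorem
(`IsChordal.exists_simplicial`) `Q` has a simplicial vertex `v`, of degree `d` say, so `ε(Q) = 1 /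
(x - d) + ε(Q - v)`.

If `v` has the same neighbours in `G`, it is simplicial there too, the terms `1 / (x - d)` agree,
and the claim reduces to `Q - v ≤ G - v`. Otherwise some edge `uv` of `G` is not in `Q`, and `P(G) =
P(G - uv) - P(G / uv)`. The two terms on the right have the same sign, so `ε(G)` is a weighted mean,
with positive weights, of `ε(G - uv)` and `ε(G / uv)`. The former is at least `ε(Q)`; the latter is
at least `ε(Q - v)`, which exceeds `ε(Q)` because `1 / (x - d) < 0`. -/

variable {V : Type*}

/-! ### Simplicial vertices of chordal graphs -/

/-- A shortest walk has no chords: adjacent vertices on it are joined by one of its edges. -/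
theorem Walk.mem_edges_of_adj_of_length_eq_dist {H : SimpleGraph V} {s t : V} (p : H.Walk s t)
    (hp : p.length = H.dist s t) {a b : V} (ha : a ∈ p.support) (hb : b ∈ p.support)
    (hab : H.Adj a b) : s(a, b) ∈ p.edges := by
  have key : ∀ i j, i ≤ j → j ≤ p.length → H.Adj (p.getVert i) (p.getVert j) →
      s(p.getVert i, p.getVert j) ∈ p.edges := by
    intro i j hij hj hadj
    have hne : i ≠ j := by
      rintro rfl
      exact hadj.ne rfl
    -- Replacing the stretch from `i` to `j` by the chord cannot shorten the walk, which forces `j =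
    -- i + 1`.
    have hle : H.dist s t ≤ ((p.take i).append (Walk.cons hadj (p.drop j))).length :=
      dist_le _
    rw [Walk.length_append, Walk.length_cons, Walk.take_length, Walk.drop_length, ← hp] at hle
    obtain rfl : j = i + 1 := by omega
    exact p.toSubgraph_adj_getVert (by omega) |> p.mem_edges_toSubgraph.mp
  obtain ⟨i, rfl, hi⟩ := Walk.mem_support_iff_exists_getVert.mp ha
  obtain ⟨j, rfl, hj⟩ := Walk.mem_support_iff_exists_getVert.mp hb
  rcases le_total i j with h | h
  · exact key i j h hj hab
  · rw [Sym2.eq_swap]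
    exact key j i h hi hab.symm

/-- The spanning subgraph keeping only the edges inside a vertex set. -/
def restrictTo (Q : SimpleGraph V) (X : Set V) : SimpleGraph V where
  Adj a b := Q.Adj a b ∧ a ∈ X ∧ b ∈ X
  symm := ⟨fun _ _ h => ⟨h.1.symm, h.2.2, h.2.1⟩⟩
  loopless := ⟨fun _ h => h.1.ne rfl⟩

theorem restrictTo_le (Q : SimpleGraph V) (X : Set V) : Q.restrictTo X ≤ Q := fun _ _ h => h.1

theorem restrictTo_mono (Q : SimpleGraph V) {X Y : Set V} (h : X ⊆ Y) :
    Q.restrictTo X ≤ Q.restrictTo Y := fun _ _ hab => ⟨hab.1, h hab.2.1, h hab.2.2⟩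

theorem Walk.mem_of_mem_support_restrictTo {Q : SimpleGraph V} {X : Set V} {s t : V}
    (p : (Q.restrictTo X).Walk s t) (hs : s ∈ X) {a : V} (ha : a ∈ p.support) : a ∈ X := by
  induction p with
  | nil => simp_all
  | cons h p ih =>
    rw [Walk.support_cons, List.mem_cons] at ha
    rcases ha with rfl | ha
    · exact hs
    · exact ih h.2.2 ha

/-- In a chordal graph, two neighbours of `v` that are joined by a walk whose inner vertices lie
outside the closed neighbourhood of `v` are adjacent. -/
theorem IsChordal.adj_of_reachable {Q : SimpleGraph V} (hQ : Q.IsChordal) {v s t : V}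
    {X : Set V} (hX : ∀ a ∈ X, a ≠ v ∧ (Q.Adj v a → a = s ∨ a = t)) (hsX : s ∈ X)
    (hs : Q.Adj v s) (ht : Q.Adj v t) (hst : s ≠ t)
    (hr : (Q.restrictTo X).Reachable s t) : Q.Adj s t := by
  by_contra hnadj
  obtain ⟨p, hp, hlen⟩ := hr.exists_path_of_dist
  have hsupp : ∀ a ∈ p.support, a ∈ X := fun a ha => p.mem_of_mem_support_restrictTo hsX ha
  set q : Q.Walk s t := p.mapLe (Q.restrictTo_le X) with hq
  have hqs : q.support = p.support := by simp [hq]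
  have hqe : q.edges = p.edges := by simp [hq]
  have hql : q.length = p.length := by simp [hq]
  have hqp : q.IsPath := (Walk.isPath_mapLe _).mpr hp
  have hvq : v ∉ q.support := by
    rw [hqs]
    exact fun h => (hX v (hsupp v h)).1 rfl
  have h2 : 2 ≤ p.length := by
    by_contra hlt
    rcases (by omega : p.length = 0 ∨ p.length = 1) with h | h
    · exact hst (Walk.eq_of_length_eq_zero h)
    · exact hnadj (Walk.adj_of_length_eq_one h).1
  -- The closed walk `v, s, ..., t, v` along a shortest path is a chordless cycle: the path has no
  -- chords, and `v` sees only `s` and `t` on it.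
  refine hQ v (Walk.cons hs (q.concat ht.symm)) ?_ ?_ ?_
  · rw [Walk.cons_isCycle_iff]
    refine ⟨hqp.concat hvq ht.symm, ?_⟩
    rw [Walk.edges_concat, List.concat_eq_append, List.mem_append, List.mem_singleton, not_or]
    refine ⟨fun h => hvq (q.fst_mem_support_of_mem_edges h), fun h => ?_⟩
    rw [Sym2.eq_iff] at h
    rcases h with ⟨h, -⟩ | ⟨-, h⟩
    · exact ht.ne h
    · exact hst h
  · rw [Walk.length_cons, Walk.length_concat]
    omega
  · have hv : ∀ a, a ∈ q.support → Q.Adj v a →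
        s(v, a) ∈ (Walk.cons hs (q.concat ht.symm)).edges := by
      intro a ha hva
      rw [Walk.edges_cons, Walk.edges_concat]
      rcases (hX a (hsupp a (hqs ▸ ha))).2 hva with rfl | rfl
      · simp
      · simp [Sym2.eq_swap]
    have hmem : ∀ a, a ∈ (Walk.cons hs (q.concat ht.symm)).support → a = v ∨ a ∈ q.support := by
      intro a ha
      simp only [Walk.support_cons, Walk.support_concat, List.mem_cons,
        List.mem_append, List.not_mem_nil, or_false] at ha
      tauto
    intro a ha b hb hab
    rw [Walk.mem_verts_toSubgraph] at ha hb
    rw [← Subgraph.mem_edgeSet, Walk.mem_edges_toSubgraph]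
    rcases hmem a ha with rfl | ha' <;> rcases hmem b hb with rfl | hb'
    · exact (hab.ne rfl).elim
    · exact hv b hb' hab
    · rw [Sym2.eq_swap]
      exact hv a ha' hab.symm
    · rw [hqs] at ha' hb'
      have := p.mem_edges_of_adj_of_length_eq_dist hlen ha' hb'
        ⟨hab, hsupp a ha', hsupp b hb'⟩
      rw [Walk.edges_cons, Walk.edges_concat, hqe]
      simp [this]

/-- In a vertex set `A` of a chordal graph, a vertex `v` with a non-neighbour in `A` has a
non-neighbour in `A` whose neighbours in `A` form a clique. -/
theorem IsChordal.exists_simplicial_not_adj [Finite V] {Q : SimpleGraph V} (hQ : Q.IsChordal)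
    (A : Set V) (v : V) (hv : v ∈ A) (hA : ∃ a ∈ A, a ≠ v ∧ ¬ Q.Adj v a) :
    ∃ w ∈ A, w ≠ v ∧ ¬ Q.Adj v w ∧ Q.IsClique (Q.neighborSet w ∩ A) := by
  induction A using WellFoundedLT.induction generalizing v with
  | ind A ih =>
  obtain ⟨a, haA, hav, hnva⟩ := hA
  -- `C` is the component of `a` among the non-neighbours of `v` in `A`, and `S` is its boundary in
  -- `A`. `S` lies in the neighbourhood of `v` and separates `v` from `C`; chordality makes it a
  -- clique.
  set N : Set V := {w ∈ A | w ≠ v ∧ ¬ Q.Adj v w} with hN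
  set C : Set V := {w | w ∈ N ∧ (Q.restrictTo N).Reachable a w} with hC
  set S : Set V := {s ∈ A | s ∉ C ∧ ∃ c ∈ C, Q.Adj s c} with hS
  have haC : a ∈ C := ⟨⟨haA, hav, hnva⟩, Reachable.refl _⟩
  have hSv : ∀ s ∈ S, Q.Adj v s := by
    rintro s ⟨hsA, hsC, c, hc, hsc⟩
    by_contra hns
    have hsv : s ≠ v := by
      rintro rfl
      exact hc.1.2.2 hsc
    have hsN : s ∈ N := ⟨hsA, hsv, hns⟩
    have hcs : (Q.restrictTo N).Adj c s := ⟨hsc.symm, hc.1, hsN⟩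
    exact hsC ⟨hsN, hc.2.trans hcs.reachable⟩
  have hSc : Q.IsClique S := by
    intro s hs t ht hst
    obtain ⟨c, hc, hsc⟩ := hs.2.2
    obtain ⟨d, hd, htd⟩ := ht.2.2
    have hNX : N ⊆ N ∪ {s, t} := Set.subset_union_left
    refine hQ.adj_of_reachable (v := v) (X := N ∪ {s, t}) ?_ (by simp) (hSv s hs) (hSv t ht)
      hst ?_
    · rintro b (hb | rfl | rfl)
      · exact ⟨hb.2.1, fun h => (hb.2.2 h).elim⟩
      · exact ⟨(hSv _ hs).ne', fun _ => Or.inl rfl⟩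
      · exact ⟨(hSv _ ht).ne', fun _ => Or.inr rfl⟩
    · have h1 : (Q.restrictTo (N ∪ {s, t})).Adj s c := ⟨hsc, by simp, hNX hc.1⟩
      have h2 : (Q.restrictTo (N ∪ {s, t})).Adj d t := ⟨htd.symm, hNX hd.1, by simp⟩
      have h3 : (Q.restrictTo (N ∪ {s, t})).Reachable c d :=
        (hc.2.symm.trans hd.2).mono (Q.restrictTo_mono hNX)
      exact (h1.reachable.trans h3).trans h2.reachable
  have hsub : C ∪ S ⊂ A := by
    refine ⟨?_, fun h => ?_⟩
    · rintro w (hw | hw)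
      · exact hw.1.1
      · exact hw.1
    · rcases h hv with h | h
      · exact h.1.2.1 rfl
      · exact (hSv v h).ne rfl
  -- A vertex of `C` has all its neighbours in `A` inside `C ∪ S`, so being simplicial there is
  -- enough.
  suffices h : ∃ w ∈ C, Q.IsClique (Q.neighborSet w ∩ (C ∪ S)) by
    obtain ⟨w, hw, hcl⟩ := h
    refine ⟨w, hw.1.1, hw.1.2.1, hw.1.2.2, hcl.subset ?_⟩
    rintro b ⟨hb, hbA⟩
    refine ⟨hb, ?_⟩
    by_cases hbC : b ∈ C
    · exact Or.inl hbC
    · exact Or.inr ⟨hbA, hbC, w, hw, Adj.symm hb⟩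
  -- If `c` is joined to all of `S`, the non-neighbour of `c` given by induction cannot be in `S`,
  -- so it lies in `C`. When no such `c` has a non-neighbour, `C ∪ S` is a clique and `a` itself
  -- serves.
  have step : ∀ c ∈ C ∪ S, (∀ s ∈ S, s = c ∨ Q.Adj c s) →
      (∃ b ∈ C ∪ S, b ≠ c ∧ ¬ Q.Adj c b) →
      ∃ w ∈ C, Q.IsClique (Q.neighborSet w ∩ (C ∪ S)) := by
    intro c hc hcS hex
    obtain ⟨w, hw, hwc, hncw, hcl⟩ := ih _ hsub c hc hex
    refine ⟨w, hw.resolve_right fun h => ?_, hcl⟩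
    rcases hcS w h with h | h
    · exact hwc h
    · exact hncw h
  by_cases h1 : ∃ s ∈ S, ∃ b ∈ C ∪ S, b ≠ s ∧ ¬ Q.Adj s b
  · obtain ⟨s, hs, hb⟩ := h1
    refine step s (Or.inr hs) (fun t ht => ?_) hb
    by_cases hst : t = s
    · exact Or.inl hst
    · exact Or.inr (hSc hs ht (Ne.symm hst))
  push Not at h1
  by_cases h2 : ∃ c ∈ C, ∃ b ∈ C ∪ S, b ≠ c ∧ ¬ Q.Adj c b
  · obtain ⟨c, hc, hb⟩ := h2
    refine step c (Or.inl hc) (fun t ht => ?_) hb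
    by_cases htc : t = c
    · exact Or.inl htc
    · exact Or.inr (h1 t ht c (Or.inl hc) (Ne.symm htc)).symm
  push Not at h2
  refine ⟨a, haC, ?_⟩
  rintro b ⟨-, hb⟩ c ⟨-, hc⟩ hbc
  rcases hb with hb | hb
  · exact h2 b hb c hc hbc.symm
  · exact h1 b hb c hc hbc.symm

/-- A nonempty finite chordal graph has a simplicial vertex. -/
theorem IsChordal.exists_simplicial [Finite V] [Nonempty V] {Q : SimpleGraph V}
    (hQ : Q.IsChordal) : ∃ v, Q.IsClique (Q.neighborSet v) := by
  by_cases h : ∃ v a, a ≠ v ∧ ¬ Q.Adj v a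
  · obtain ⟨v, a, ha⟩ := h
    obtain ⟨w, -, -, -, hw⟩ :=
      hQ.exists_simplicial_not_adj Set.univ v (Set.mem_univ v) ⟨a, Set.mem_univ a, ha⟩
    exact ⟨w, by simpa using hw⟩
  · push Not at h
    obtain ⟨v⟩ := ‹Nonempty V›
    exact ⟨v, fun a _ b _ hab => h a b hab.symm⟩

/-- An embedding carries cycles to cycles of the same length, and pulling back adjacency keeps every
chord, so an induced cycle maps to an induced cycle. -/
theorem IsChordal.comap {W : Type*} {Q : SimpleGraph V} (hQ : Q.IsChordal) (f : W ↪ V) :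
    (Q.comap f).IsChordal := by
  intro u C hC hlen hind
  let φ : Q.comap f →g Q := (Embedding.comap f Q).toHom
  have hφ : Function.Injective φ := f.injective
  refine hQ _ (C.map φ) ((Walk.isCycle_map_iff_of_injective hφ).mpr hC) (by simpa using hlen) ?_
  rw [Walk.toSubgraph_map]
  rintro a ⟨a, ha, rfl⟩ b ⟨b, hb, rfl⟩ hab
  exact ⟨a, b, hind ha hb hab, rfl, rfl⟩

/-! ### Deletion–contraction -/

theorem eq_chromaticPolynomial [Finite V] (G : SimpleGraph V) (p : Polynomial ℝ)
    (hp : ∀ k : ℕ, 0 < k → p.eval (k : ℝ) = Nat.card (G.Coloring (Fin k))) :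
    G.chromaticPolynomial = p :=
  (existsUnique_chromaticPolynomial G).unique G.chromaticPolynomial_eval hp

theorem chromaticPolynomial_of_isEmpty [IsEmpty V] (G : SimpleGraph V) :
    G.chromaticPolynomial = 1 := by
  refine G.eq_chromaticPolynomial 1 fun k _ => ?_
  have : Unique (G.Coloring (Fin k)) :=
    { default := Coloring.mk isEmptyElim (fun {a} => isEmptyElim a)
      uniq := fun c => RelHom.ext fun a => isEmptyElim a }
  simp

/-- The graph obtained from `G` by removing the vertex `v`. -/
def removeVertex (G : SimpleGraph V) (v : V) : SimpleGraph {w // w ≠ v} :=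
  G.comap (Function.Embedding.subtype _)

/-- The graph obtained from `G` by merging the vertex `v` into the vertex `u`. -/
def mergeVertex (G : SimpleGraph V) (u v : V) : SimpleGraph {w // w ≠ v} where
  Adj a b := a ≠ b ∧ (G.Adj a b ∨ (a.1 = u ∧ G.Adj v b) ∨ (b.1 = u ∧ G.Adj v a))
  symm := ⟨fun _ _ h => ⟨h.1.symm, h.2.imp (fun h => h.symm) Or.symm⟩⟩
  loopless := ⟨fun _ h => h.1 rfl⟩

/-- Both graphs live on the vertices other than `v`; this makes `Q - v` a spanning subgraph of `G /
uv`, so the induction hypothesis can compare them. -/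
theorem removeVertex_le_mergeVertex (G : SimpleGraph V) (u v : V) :
    G.removeVertex v ≤ G.mergeVertex u v := fun _ _ h => ⟨h.ne, Or.inl h⟩

theorem removeVertex_mono {G H : SimpleGraph V} (h : G ≤ H) (v : V) :
    G.removeVertex v ≤ H.removeVertex v := fun _ _ hab => h hab

/-- Colourings of `G` correspond to the colourings of `G - uv` that separate `u` and `v`. -/
def coloringEquivDeleteEdge {α : Type*} (G : SimpleGraph V) {u v : V} (huv : G.Adj u v) :
    {c : (G.deleteEdges {s(u, v)}).Coloring α // c u ≠ c v} ≃ G.Coloring α where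
  toFun c := Coloring.mk c.1 fun {a b} hab => by
    by_cases h : s(a, b) = s(u, v)
    · rcases Sym2.eq_iff.mp h with ⟨rfl, rfl⟩ | ⟨rfl, rfl⟩
      · exact c.2
      · exact c.2.symm
    · exact c.1.valid (by simpa [deleteEdges_adj, hab] using h)
  invFun c := ⟨Coloring.mk c fun {_ _} hab => c.valid (deleteEdges_le _ hab), c.valid huv⟩
  left_inv _ := rfl
  right_inv _ := rfl

open Classical in
/-- Colourings of the contraction `G / uv` correspond to the colourings of `G - uv` that agree
on `u` and `v`. -/
noncomputable def coloringEquivMergeVertex {α : Type*} (G : SimpleGraph V) {u v : V}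
    (huv : G.Adj u v) :
    {c : (G.deleteEdges {s(u, v)}).Coloring α // ¬ c u ≠ c v} ≃
      (G.mergeVertex u v).Coloring α where
  toFun c := Coloring.mk (fun w => c.1 w) fun {a b} hab => by
    have hc : c.1 u = c.1 v := not_not.mp c.2
    obtain ⟨hne, h⟩ := hab
    have hne' : a.1 ≠ b.1 := fun h => hne (Subtype.ext h)
    have ha := a.2
    have hb := b.2
    rcases h with h | ⟨h, h'⟩ | ⟨h, h'⟩
    · exact c.1.valid (by simp [deleteEdges_adj, h, ha, hb])
    · rw [h] at hne' ⊢
      rw [hc]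
      exact c.1.valid (by simp [deleteEdges_adj, h', hb, hne'.symm, huv.ne'])
    · rw [h] at hne' ⊢
      rw [hc]
      exact (c.1.valid (by simp [deleteEdges_adj, h', ha, hne', huv.ne'])).symm
  invFun c := ⟨Coloring.mk (fun w => if h : w = v then c ⟨u, huv.ne⟩ else c ⟨w, h⟩)
    fun {a b} hab => by
      rw [deleteEdges_adj, Set.mem_singleton_iff] at hab
      obtain ⟨hab, hne⟩ := hab
      by_cases ha : a = v <;> by_cases hb : b = v
      · exact (hab.ne (ha.trans hb.symm)).elim
      · subst ha
        have hbu : b ≠ u := fun h => hne (by rw [h, Sym2.eq_swap])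
        simp only [dif_pos, dif_neg hb]
        exact c.valid ⟨fun h => hbu (congrArg Subtype.val h).symm, Or.inr (Or.inl ⟨rfl, hab⟩)⟩
      · subst hb
        have hau : a ≠ u := fun h => hne (by rw [h])
        simp only [dif_pos, dif_neg ha]
        exact c.valid ⟨fun h => hau (congrArg Subtype.val h), Or.inr (Or.inr ⟨rfl, hab.symm⟩)⟩
      · simp only [dif_neg ha, dif_neg hb]
        exact c.valid ⟨fun h => hab.ne (congrArg Subtype.val h), Or.inl hab⟩,
    by
      rw [not_not]
      change (if h : u = v then _ else _) = (if h : v = v then _ else _)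
      rw [dif_neg huv.ne, dif_pos rfl]⟩
  left_inv c := by
    have hc : c.1 u = c.1 v := not_not.mp c.2
    refine Subtype.ext (RelHom.ext fun w => ?_)
    change (if h : w = v then c.1 u else c.1 w) = c.1 w
    split_ifs with h
    · rw [hc, h]
    · rfl
  right_inv c := by
    refine RelHom.ext fun w => ?_
    change (if h : w.1 = v then c ⟨u, huv.ne⟩ else c ⟨w.1, h⟩) = c w
    rw [dif_neg w.2]

instance finite_coloring {α : Type*} [Finite V] [Finite α] (G : SimpleGraph V) :
    Finite (G.Coloring α) :=
  Finite.of_injective (fun c : G.Coloring α => (c : V → α)) DFunLike.coe_injective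

/-- Deletion–contraction. -/
theorem chromaticPolynomial_eq_sub [Finite V] (G : SimpleGraph V) {u v : V} (huv : G.Adj u v) :
    G.chromaticPolynomial = (G.deleteEdges {s(u, v)}).chromaticPolynomial -
      (G.mergeVertex u v).chromaticPolynomial := by
  classical
  refine G.eq_chromaticPolynomial _ fun k hk => ?_
  rw [Polynomial.eval_sub, chromaticPolynomial_eval _ k hk, chromaticPolynomial_eval _ k hk,
    sub_eq_iff_eq_add, ← Nat.card_congr (G.coloringEquivDeleteEdge huv),
    ← Nat.card_congr (G.coloringEquivMergeVertex huv), ← Nat.cast_add, ← Nat.card_sum]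
  exact congrArg _ (Nat.card_congr (Equiv.sumCompl _).symm)

/-! ### The factor of a simplicial vertex -/

open Classical in
/-- A colouring of `G` is a colouring of `G - v` together with a colour for `v` that does not
appear among its neighbours. -/
noncomputable def coloringEquivSigma {α : Type*} (G : SimpleGraph V) (v : V) :
    G.Coloring α ≃ Σ c : (G.removeVertex v).Coloring α,
      {x : α // ∀ w : {w // w ≠ v}, G.Adj v w → c w ≠ x} where
  toFun c := ⟨Coloring.mk (fun w => c w) fun {_ _} hab => c.valid hab,
    ⟨c v, fun _ hw => (c.valid hw).symm⟩⟩
  invFun c := Coloring.mk (fun w => if h : w = v then c.2.1 else c.1 ⟨w, h⟩) fun {a b} hab => by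
    by_cases ha : a = v <;> by_cases hb : b = v
    · exact (hab.ne (ha.trans hb.symm)).elim
    · subst ha
      simp only [dif_pos, dif_neg hb]
      exact (c.2.2 ⟨b, hb⟩ hab).symm
    · subst hb
      simp only [dif_pos, dif_neg ha]
      exact c.2.2 ⟨a, ha⟩ hab.symm
    · simp only [dif_neg ha, dif_neg hb]
      exact c.1.valid hab
  left_inv c := by
    refine RelHom.ext fun w => ?_
    change (if h : w = v then c v else c w) = c w
    split_ifs with h
    · rw [h]
    · rfl
  right_inv c := by
    obtain ⟨c, x, hx⟩ := c
    have h1 : (Coloring.mk (fun w : {w // w ≠ v} => if h : w.1 = v then x else c ⟨w.1, h⟩)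
        (fun {a b} hab => by
          rw [dif_neg a.2, dif_neg b.2]
          exact c.valid hab) : (G.removeVertex v).Coloring α) = c :=
      RelHom.ext fun w => by
        change (if h : w.1 = v then x else c ⟨w.1, h⟩) = c w
        rw [dif_neg w.2]
    refine Sigma.ext h1 ?_
    refine (Subtype.heq_iff_coe_eq fun y => ?_).mpr ?_
    · exact iff_of_eq (congrArg (fun d : (G.removeVertex v).Coloring α =>
        ∀ w : {w // w ≠ v}, G.Adj v w → d w ≠ y) h1)
    · change (if h : v = v then x else c ⟨v, h⟩) = x
      rw [dif_pos rfl]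

/-- The neighbours of `v` form a clique, so `c` is injective on them and they forbid exactly as many
colours as there are neighbours. -/
theorem card_extensions_of_isClique [Finite V] {G : SimpleGraph V} {v : V}
    (hv : G.IsClique (G.neighborSet v)) {k : ℕ} (c : (G.removeVertex v).Coloring (Fin k)) :
    (Nat.card {x : Fin k // ∀ w : {w // w ≠ v}, G.Adj v w → c w ≠ x} : ℝ) =
      k - Nat.card (G.neighborSet v) := by
  classical
  let f : G.neighborSet v → Fin k := fun w => c ⟨w.1, (G.ne_of_adj w.2).symm⟩
  have hf : Function.Injective f := by
    intro a b hab
    by_contra hne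
    have hadj : G.Adj a b := hv a.2 b.2 fun h => hne (Subtype.ext h)
    exact c.valid (v := ⟨a.1, (G.ne_of_adj a.2).symm⟩) (w := ⟨b.1, (G.ne_of_adj b.2).symm⟩)
      hadj hab
  have e : {x : Fin k // ∀ w : {w // w ≠ v}, G.Adj v w → c w ≠ x} ≃
      {x // ¬ x ∈ Set.range f} := Equiv.subtypeEquivRight fun x => by
    constructor
    · rintro h ⟨w, hw⟩
      exact h ⟨w.1, (G.ne_of_adj w.2).symm⟩ w.2 hw
    · intro h w hw hx
      exact h ⟨⟨w.1, hw⟩, hx⟩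
  have hcard := Nat.card_congr (Equiv.sumCompl (fun x : Fin k => x ∈ Set.range f))
  rw [Nat.card_sum, Nat.card_fin] at hcard
  have hr : Nat.card {x // x ∈ Set.range f} = Nat.card (G.neighborSet v) :=
    (Nat.card_congr (Equiv.ofInjective f hf)).symm
  rw [Nat.card_congr e, ← hr, eq_sub_iff_add_eq, add_comm]
  exact_mod_cast hcard

/-- A simplicial vertex of degree `d` contributes the factor `X - d`. -/
theorem chromaticPolynomial_of_isClique_neighborSet [Finite V] {G : SimpleGraph V} {v : V}
    (hv : G.IsClique (G.neighborSet v)) :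
    G.chromaticPolynomial = (Polynomial.X - Polynomial.C (Nat.card (G.neighborSet v) : ℝ)) *
      (G.removeVertex v).chromaticPolynomial := by
  refine G.eq_chromaticPolynomial _ fun k hk => ?_
  have := Fintype.ofFinite ((G.removeVertex v).Coloring (Fin k))
  rw [Polynomial.eval_mul, chromaticPolynomial_eval _ k hk,
    Nat.card_congr (G.coloringEquivSigma v), Nat.card_sigma, Nat.cast_sum,
    Finset.sum_congr rfl fun c _ => card_extensions_of_isClique hv c]
  simp
  ring

theorem IsChordal.removeVertex {V : Type*} {Q : SimpleGraph V} (hQ : Q.IsChordal) (v : V) :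
    (Q.removeVertex v).IsChordal :=
  hQ.comap _

/-- A simplicial vertex of degree `d` contributes `1 / (x - d)` to `ε(G, x)`. -/
theorem chromaticEpsilon_of_isClique_neighborSet {V : Type*} [Finite V] {G : SimpleGraph V}
    {v : V} (hv : G.IsClique (G.neighborSet v)) {x : ℝ} (hx : x < 0)
    (hP : (G.removeVertex v).chromaticPolynomial.eval x ≠ 0) :
    G.chromaticEpsilon x =
      1 / (x - Nat.card (G.neighborSet v)) + (G.removeVertex v).chromaticEpsilon x := by
  have hd : x - (Nat.card (G.neighborSet v) : ℝ) ≠ 0 := by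
    have : (0 : ℝ) ≤ Nat.card (G.neighborSet v) := Nat.cast_nonneg _
    linarith
  rw [chromaticEpsilon, chromaticEpsilon, chromaticPolynomial_of_isClique_neighborSet hv]
  simp only [Polynomial.derivative_mul, Polynomial.derivative_sub, Polynomial.derivative_X,
    Polynomial.derivative_C, Polynomial.eval_add, Polynomial.eval_mul, Polynomial.eval_sub,
    Polynomial.eval_X, Polynomial.eval_C, sub_zero, Polynomial.eval_one]
  field_simp

/-- The extra factor `x - d` is negative, so one more vertex flips the sign. -/
theorem neg_one_pow_mul_eval_pos_of_isClique_neighborSet {V : Type*} [Finite V]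
    {G : SimpleGraph V} {v : V} (hv : G.IsClique (G.neighborSet v)) {x : ℝ} (hx : x < 0) {n : ℕ}
    (hP : 0 < (-1) ^ n * (G.removeVertex v).chromaticPolynomial.eval x) :
    0 < (-1) ^ (n + 1) * G.chromaticPolynomial.eval x := by
  have hd : (0 : ℝ) ≤ Nat.card (G.neighborSet v) := Nat.cast_nonneg _
  rw [chromaticPolynomial_of_isClique_neighborSet hv, Polynomial.eval_mul, Polynomial.eval_sub,
    Polynomial.eval_X, Polynomial.eval_C]
  have := mul_pos (by linarith : 0 < Nat.card (G.neighborSet v) - x) hP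
  calc _ < _ := this
    _ = _ := by ring

/-! ### The comparison by double induction -/

/-- The values of `P(G, ·)` and `P(Q, ·)` at a negative number have the sign `(-1) ^ n`, and
`ε(Q, x) ≤ ε(G, x)`, with equality only for `G = Q`. -/
theorem chromaticEpsilon_comparison.{u} {x : ℝ} (hx : x < 0) (n : ℕ) :
    ∀ {V : Type u} [Finite V] (G Q : SimpleGraph V), Nat.card V = n → Q.IsChordal → Q ≤ G →
      0 < (-1) ^ n * G.chromaticPolynomial.eval x ∧
      0 < (-1) ^ n * Q.chromaticPolynomial.eval x ∧
      Q.chromaticEpsilon x ≤ G.chromaticEpsilon x ∧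
      (Q ≠ G → Q.chromaticEpsilon x < G.chromaticEpsilon x) := by
  induction n with
  | zero =>
    intro V _ G Q hn _ _
    have : IsEmpty V := (Nat.card_eq_zero.mp hn).resolve_right fun h => h.not_finite ‹_›
    obtain rfl : Q = G := by
      ext a
      exact isEmptyElim a
    simp [chromaticPolynomial_of_isEmpty]
  | succ n ih =>
    intro V _ G Q hn hQ hQG
    have : Nonempty V := (Nat.card_pos_iff.mp (by omega)).1
    obtain ⟨v, hv⟩ := hQ.exists_simplicial
    have hcard : Nat.card {w // w ≠ v} = n := by
      classical
      have := Fintype.ofFinite V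
      rw [Nat.card_eq_fintype_card] at hn ⊢
      rw [Fintype.card_subtype_compl, Fintype.card_subtype_eq, hn]
      rfl
    have ne_of_pos : ∀ {m : ℕ} {y : ℝ}, 0 < (-1) ^ m * y → y ≠ 0 := by
      rintro m y h rfl
      simp at h
    -- The inner induction keeps `Q` and `v` fixed, while `ih` still covers all graphs on `n`
    -- vertices.
    induction G using WellFoundedLT.induction with
    | ind G ihG =>
    by_cases hN : ∀ u, G.Adj v u → Q.Adj v u
    · have hNeq : G.neighborSet v = Q.neighborSet v :=
        Set.ext fun u => ⟨fun h => hN u h, fun h => hQG h⟩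
      have hvG : G.IsClique (G.neighborSet v) := by
        rw [hNeq]
        exact fun a ha b hb hab => hQG (hv ha hb hab)
      obtain ⟨h1, h2, h3, h4⟩ := ih (G.removeVertex v) (Q.removeVertex v) hcard
        (hQ.removeVertex v) (removeVertex_mono hQG v)
      rw [chromaticEpsilon_of_isClique_neighborSet hvG hx (ne_of_pos h1),
        chromaticEpsilon_of_isClique_neighborSet hv hx (ne_of_pos h2), hNeq]
      refine ⟨neg_one_pow_mul_eval_pos_of_isClique_neighborSet hvG hx h1,
        neg_one_pow_mul_eval_pos_of_isClique_neighborSet hv hx h2, by linarith, fun hne => ?_⟩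
      have : Q.removeVertex v ≠ G.removeVertex v := by
        refine fun heq => hne (le_antisymm hQG fun a b hab => ?_)
        by_cases ha : a = v
        · subst ha
          exact hN b hab
        by_cases hb : b = v
        · subst hb
          exact (hN a hab.symm).symm
        have h : (G.removeVertex v).Adj ⟨a, ha⟩ ⟨b, hb⟩ := hab
        rwa [← heq] at h
      linarith [h4 this]
    · push Not at hN
      obtain ⟨u, hvu, hnvu⟩ := hN
      have hQe : Q ≤ G.deleteEdges {s(u, v)} := by
        intro a b hab
        rw [deleteEdges_adj, Set.mem_singleton_iff]
        refine ⟨hQG hab, fun h => hnvu ?_⟩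
        rcases Sym2.eq_iff.mp h with ⟨rfl, rfl⟩ | ⟨rfl, rfl⟩
        · exact hab.symm
        · exact hab
      have hlt : G.deleteEdges {s(u, v)} < G := by
        refine lt_of_le_of_ne (deleteEdges_le _) fun h => ?_
        have := hvu.symm
        rw [← h, deleteEdges_adj] at this
        exact this.2 rfl
      -- Only the weak inequality is available here, since `G - uv` may be `Q` itself; strictness
      -- will come from the contraction.
      obtain ⟨h1, h2, h3, -⟩ := ihG _ hlt hQe
      obtain ⟨k1, k2, k3, -⟩ := ih (G.mergeVertex u v) (Q.removeVertex v) hcard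
        (hQ.removeVertex v) ((removeVertex_mono hQG v).trans (removeVertex_le_mergeVertex _ _ _))
      have hQeps := chromaticEpsilon_of_isClique_neighborSet hv hx (ne_of_pos k2)
      have hd : 1 / (x - Nat.card (Q.neighborSet v)) < 0 := by
        have : (0 : ℝ) ≤ Nat.card (Q.neighborSet v) := Nat.cast_nonneg _
        exact one_div_neg.mpr (by linarith)
      have hP := G.chromaticPolynomial_eq_sub hvu.symm
      -- `G / uv` has one vertex fewer, so its opposite sign turns the difference into a sum of
      -- positive terms.
      have hPe : (-1) ^ (n + 1) * G.chromaticPolynomial.eval x =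
          (-1) ^ (n + 1) * (G.deleteEdges {s(u, v)}).chromaticPolynomial.eval x +
          (-1) ^ n * (G.mergeVertex u v).chromaticPolynomial.eval x := by
        rw [hP, Polynomial.eval_sub]
        ring
      have hGpos : 0 < (-1) ^ (n + 1) * G.chromaticPolynomial.eval x := by
        rw [hPe]
        exact add_pos h1 k1
      have epsMul : ∀ {W : Type u} [Finite W] (H : SimpleGraph W) {m : ℕ},
          0 < (-1) ^ m * H.chromaticPolynomial.eval x →
          (-1) ^ m * H.chromaticPolynomial.derivative.eval x =
            H.chromaticEpsilon x * ((-1) ^ m * H.chromaticPolynomial.eval x) := by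
        intro W _ H m h
        have := ne_of_pos h
        rw [chromaticEpsilon]
        field_simp
      have hDe : (-1) ^ (n + 1) * G.chromaticPolynomial.derivative.eval x =
          (-1) ^ (n + 1) * (G.deleteEdges {s(u, v)}).chromaticPolynomial.derivative.eval x +
          (-1) ^ n * (G.mergeVertex u v).chromaticPolynomial.derivative.eval x := by
        rw [hP, Polynomial.derivative_sub, Polynomial.eval_sub]
        ring
      rw [epsMul G hGpos, epsMul _ h1, epsMul _ k1] at hDe
      -- After clearing the positive denominator, this is the weighted-mean inequality, strict in
      -- the contraction term.
      have hstrict : Q.chromaticEpsilon x < G.chromaticEpsilon x := by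
        refine lt_of_mul_lt_mul_right ?_ hGpos.le
        rw [hDe, hPe, mul_add]
        exact add_lt_add_of_le_of_lt (mul_le_mul_of_nonneg_right h3 h1.le)
          (mul_lt_mul_of_pos_right (by linarith) k1)
      exact ⟨hGpos, h2, hstrict.le, fun _ => hstrict⟩

end SimpleGraph

theorem mainTheorem2 {V : Type*} [Finite V] (G Q : SimpleGraph V)
    (hQ : Q.IsChordal) (hQG : Q < G) (x : ℝ) (hx : x < 0) :
    G.chromaticPolynomial.eval x ≠ 0 ∧ Q.chromaticPolynomial.eval x ≠ 0 ∧
      G.chromaticEpsilon x > Q.chromaticEpsilon x := by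
  obtain ⟨h1, h2, -, h4⟩ :=
    SimpleGraph.chromaticEpsilon_comparison hx (Nat.card V) G Q rfl hQ hQG.le
  exact ⟨right_ne_zero_of_mul h1.ne', right_ne_zero_of_mul h2.ne', h4 hQG.ne⟩
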